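/- \textbf{Setting.} Systems are nonzero finite-dimensional Hilbert spaces with a chosen orthonormal basis, and $I=\mathbb C$. $\mathbf{CP}(A,B)$ is the set of completely positive maps $\mathcal L(A)\to\mathcal L(B)$ and $\mathbf{QC}(A,B)$ the set of quantum channels, i.e. trace-preserving elements of $\mathbf{CP}(A,B)$. The category $\mathbf{CP}$ is compact closed: $A^*$ is the dual system, and cups and caps are the unnormalised maximally entangled state and effect. For a set $K\subseteq\mathbf{QC}(A,A')$ and systems $X,X'$ let $$\mathrm{dExt}_{X,X'}(K)=\{\Phi\in\mathbf{QC}(A\otimes X,A'\otimes X') : (\mathrm{id}_{A'}\otimes\sigma)\circ\Phi\circ(\mathrm{id}_A\otimes\rho)\in K\ \text{ for all }\rho\in\mathbf{QC}(I,X),\ \sigma\in\mathbf{QC}(X',I)\}.$$ $K$ is \emph{normal} if $\rho\circ d\in K$ for every $d\in\mathbf{QC}(A,I)$ and $\rho\in\mathbf{QC}(I,A')$. Let $n\ge 0$, let $K_i\subseteq\mathbf{QC}(A_i,A_i')$ for $1\le i\le n$ and let $M\subseteq\mathbf{QC}(B,B')$. A \emph{locally-applicable transformation} of type $K_1\dots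 K_n\to M$ is a family of functions, one for all systems $X_1,X_1',\dots,X_n,X_n'$, $$T_{X,X'}:\ \prod_{i=1}^n\mathrm{dExt}_{X_i,X_i'}(K_i)\longrightarrow \mathrm{dExt}_{X_1\otimes\cdots\otimes X_n,\;X_1'\otimes\cdots\otimes X_n'}(M),$$ such that for all systems $Y_i,Y_i',Z_i$, all channels $f_i:Y_i\to X_i\otimes Z_i$ and $g_i:X_i'\otimes Z_i\to Y_i'$ and all $\phi_i\in\mathrm{dExt}_{X_i,X_i'}(K_i)$, up to the canonical reordering of tensor factors, $$T_{Y,Y'}\Big(\big((\mathrm{id}_{A_i'}\otimes g_i)\circ(\phi_i\otimes\mathrm{id}_{Z_i})\circ(\mathrm{id}_{A_i}\otimes f_i)\big)_{i}\Big)=\Big(\mathrm{id}_{B'}\otimes\bigotimes_i g_i\Big)\circ\Big(T_{X,X'}\big((\phi_i)_i\big)\otimes\mathrm{id}_{\bigotimes_i Z_i}\Big)\circ\Big(\mathrm{id}_B\otimes\bigotimes_i f_i\Big).$$ A map $S\in\mathbf{CP}\big(\bigotimes_i(A_i^*\otimes A_i'),\,B^*\otimes B'\big)$ acts on families of channels $\phi_i:A_i\otimes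 X_i\to A_i'\otimes X_i'$ by bending the wires $A_i$ with cups, applying $S$ to all wires $A_i^*,A_i'$, and bending $B^*$ back with a cap; equivalently, $S\otimes\mathrm{id}$ is applied to the tensor product of the Choi operators of the $\phi_i$, and the result is read as the Choi operator of a map $S[\phi_1,\dots,\phi_n]:B\otimes X_1\otimes\cdots\otimes X_n\to B'\otimes X_1'\otimes\cdots\otimes X_n'$. Such an $S$ is a \emph{$\mathbf{CP}$-supermap} of type $K_1\dots K_n\to M$ if, for all systems $X_i,X_i'$ and all $\phi_i\in\mathrm{dExt}_{X_i,X_i'}(K_i)$, the map $S[\phi_1,\dots,\phi_n]$ is in $\mathrm{dExt}_{X_1\otimes\cdots\otimes X_n,\,X_1'\otimes\cdots\otimes X_n'}(M)$. \textbf{Corollary (multi-input correspondence).} Let $K_1,\dots,K_n,M$ be convex sets of quantum channels as above, with $K_1,\dots,K_n$ normal. Then the assignment sending a $\mathbf{CP}$-supermap $S$ to the family $T_{X,X'}(\phi_1,\dots,\phi_n)=S[\phi_1,\dots,\phi_n]$ is a bijection from the $\mathbf{CP}$-supermaps of type $K_1\dots K_n\to M$ onto the locally-applicable transformations of type $K_1\dots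 K_n\to M$. -/

import Mathlib

namespace QSupermap

/-- A (nonzero, finite-dimensional) quantum system: the finite set labelling an orthonormal basis
of its Hilbert space `ℂ^A`. -/
structure Sys where
  carrier : Type
  [fintype : Fintype carrier]
  [decEq : DecidableEq carrier]
  [nonempty : Nonempty carrier]

instance : CoeSort Sys Type := ⟨Sys.carrier⟩

instance (A : Sys) : Fintype A := A.fintype
instance (A : Sys) : DecidableEq A := A.decEq
instance (A : Sys) : Nonempty A := A.nonempty

/-- Tensor product of a finite family of systems. -/
abbrev Sys.pi {n : ℕ} (X : Fin n → Sys) : Sys := ⟨∀ i, X i⟩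

/-- Linear maps `L(ℂ^A) → L(ℂ^B)`. The basis of `ℂ^A ⊗ ℂ^C` is labelled by `A × C`. -/
abbrev Lin (A B : Type) := Matrix A A ℂ →ₗ[ℂ] Matrix B B ℂ

/-- `f ⊗ id_R`. -/
def ampL {A B : Type} (f : Lin A B) (R : Type) : Lin (A × R) (B × R) where
  toFun M := Matrix.of fun p q =>
    f (Matrix.of fun a a' => M (a, p.2) (a', q.2)) p.1 q.1
  map_add' M N := by
    ext p q
    exact congrFun (congrFun (f.map_add (Matrix.of fun a a' => M (a, p.2) (a', q.2))
      (Matrix.of fun a a' => N (a, p.2) (a', q.2))) p.1) q.1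
  map_smul' c M := by
    ext p q
    exact congrFun (congrFun (f.map_smul c (Matrix.of fun a a' => M (a, p.2) (a', q.2))) p.1) q.1

/-- `id_R ⊗ f`. -/
def ampR (R : Type) {A B : Type} (f : Lin A B) : Lin (R × A) (R × B) where
  toFun M := Matrix.of fun p q =>
    f (Matrix.of fun a a' => M (p.1, a) (q.1, a')) p.2 q.2
  map_add' M N := by
    ext p q
    exact congrFun (congrFun (f.map_add (Matrix.of fun a a' => M (p.1, a) (q.1, a'))
      (Matrix.of fun a a' => N (p.1, a) (q.1, a'))) p.2) q.2
  map_smul' c M := by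
    ext p q
    exact congrFun (congrFun (f.map_smul c (Matrix.of fun a a' => M (p.1, a) (q.1, a'))) p.2) q.2

/-- Parallel composition `f ⊗ g`. -/
def tensor {A B C D : Type} (f : Lin A B) (g : Lin C D) : Lin (A × C) (B × D) :=
  ampR B g ∘ₗ ampL f C

/-- On product operators `f ⊗ g` acts as expected. -/
theorem tensor_kronecker {A B C D : Type} (f : Lin A B) (g : Lin C D)
    (M : Matrix A A ℂ) (N : Matrix C C ℂ) :
    tensor f g (Matrix.kroneckerMap (· * ·) M N) = Matrix.kroneckerMap (· * ·) (f M) (g N) := by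
  ext ⟨b, d⟩ ⟨b', d'⟩
  have h1 : ∀ c c' : C, (Matrix.of fun a a' => M a a' * N c c') = N c c' • M := by
    intro c c'; ext a a'; simp [mul_comm]
  have h2 : (Matrix.of fun c c' => N c c' * f M b b') = f M b b' • N := by
    ext c c'; simp [mul_comm]
  simp [tensor, ampL, ampR, h1, h2]

/-- The canonical unitary identification given by a relabelling of the basis. -/
def relabel {A B : Type} (e : A ≃ B) : Lin A B :=
  (Matrix.reindexLinearEquiv ℂ ℂ e e).toLinearMap

open scoped ComplexOrder in
/-- Complete positivity: `f ⊗ id` on `L(ℂ^A ⊗ ℂ^k)` preserves positive semidefinite operators for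
every `k`. -/
def IsCP {A B : Type} (f : Lin A B) : Prop :=
  ∀ (k : ℕ) (M : Matrix (A × Fin k) (A × Fin k) ℂ), M.PosSemidef → (ampL f (Fin k) M).PosSemidef

/-- A quantum channel: a completely positive trace-preserving map. -/
def IsChannel {A B : Type} [Fintype A] [Fintype B] (f : Lin A B) : Prop :=
  IsCP f ∧ ∀ M, (f M).trace = M.trace

/-- The Choi operator `∑ₐₐ' |a⟩⟨a'| ⊗ f(|a⟩⟨a'|)` on `A* ⊗ B`, i.e. `f` applied to one half of the
cup on `A`. -/
def choi {A B : Type} [DecidableEq A] (f : Lin A B) : Matrix (A × B) (A × B) ℂ :=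
  Matrix.of fun p q => f (Matrix.single p.1 q.1 1) p.2 q.2

/-- The map with a given Choi operator (bending the wire `A*` back with the cap). -/
def unchoi {A B : Type} [Fintype A] (C : Matrix (A × B) (A × B) ℂ) : Lin A B where
  toFun M := Matrix.of fun b b' => ∑ a, ∑ a', M a a' * C (a, b) (a', b')
  map_add' M N := by
    ext b b'
    simp [add_mul, Finset.sum_add_distrib]
  map_smul' c M := by
    ext b b'
    simp [Finset.mul_sum, mul_assoc]

theorem unchoi_choi {A B : Type} [Fintype A] [DecidableEq A] (f : Lin A B) :
    unchoi (choi f) = f := by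
  ext M b b'
  conv_rhs => rw [Matrix.matrix_eq_sum_single M]
  have h : ∀ a a' : A, Matrix.single a a' (M a a') = M a a' • Matrix.single a a' (1 : ℂ) := by
    intro a a'; simp
  simp only [h, map_sum, map_smul, Matrix.sum_apply, Matrix.smul_apply, smul_eq_mul]
  simp [unchoi, choi]

theorem choi_unchoi {A B : Type} [Fintype A] [DecidableEq A] (C : Matrix (A × B) (A × B) ℂ) :
    choi (unchoi C) = C := by
  ext ⟨a, b⟩ ⟨a', b'⟩
  simp only [choi, unchoi, LinearMap.coe_mk, AddHom.coe_mk, Matrix.of_apply]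
  rw [Finset.sum_eq_single a, Finset.sum_eq_single a'] <;>
    simp +contextual [Matrix.single_apply, eq_comm]

/-- Tensor product `f₁ ⊗ … ⊗ fₙ` of a family of maps. -/
def piTensor {n : ℕ} {X Y : Fin n → Type} [∀ i, Fintype (X i)] [∀ i, DecidableEq (X i)]
    (f : ∀ i, Lin (X i) (Y i)) : Lin (∀ i, X i) (∀ i, Y i) :=
  unchoi (Matrix.of fun p q => ∏ i, choi (f i) (p.1 i, p.2 i) (q.1 i, q.2 i))

/-- On product operators `f₁ ⊗ … ⊗ fₙ` acts as expected. -/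
theorem piTensor_prod {n : ℕ} {X Y : Fin n → Type} [∀ i, Fintype (X i)] [∀ i, DecidableEq (X i)]
    (f : ∀ i, Lin (X i) (Y i)) (M : ∀ i, Matrix (X i) (X i) ℂ) :
    piTensor f (Matrix.of fun x x' => ∏ i, M i (x i) (x' i)) =
      Matrix.of fun y y' => ∏ i, f i (M i) (y i) (y' i) := by
  ext y y'
  have h : ∀ i, f i (M i) (y i) (y' i) =
      ∑ a, ∑ a', M i a a' * choi (f i) (a, y i) (a', y' i) := fun i =>
    (congrFun (congrFun (congrArg (fun g : Lin (X i) (Y i) => g (M i))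
      (unchoi_choi (f i))) (y i)) (y' i)).symm
  simp only [Matrix.of_apply, h]
  simp only [piTensor, unchoi, LinearMap.coe_mk, AddHom.coe_mk, Matrix.of_apply,
    Finset.prod_univ_sum, Fintype.piFinset_univ, ← Finset.prod_mul_distrib]

/-- Insert a state `ρ : I → X` and an effect `σ : X' → I` on the auxiliary wires of
`Φ : A ⊗ X → A' ⊗ X'`; the unit object is `I = ℂ^Unit`. -/
def reduce {A A' X X' : Type} (Φ : Lin (A × X) (A' × X')) (ρ : Lin Unit X) (σ : Lin X' Unit) :
    Lin A A' :=
  relabel (Equiv.prodPUnit A') ∘ₗ tensor LinearMap.id σ ∘ₗ Φ ∘ₗ tensor LinearMap.id ρ ∘ₗ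
    relabel (Equiv.prodPUnit A).symm

/-- The dilation extension of a set `K` of channels by `X, X'`: all channels
`A ⊗ X → A' ⊗ X'` that reduce to an element of `K` whenever a state and an effect of the category of
channels are inserted on the auxiliary systems. -/
def dExt {A A' : Type} [Fintype A] [Fintype A'] (K : Set (Lin A A')) (X X' : Type)
    [Fintype X] [Fintype X'] : Set (Lin (A × X) (A' × X')) :=
  {Φ | IsChannel Φ ∧ ∀ (ρ : Lin Unit X) (σ : Lin X' Unit), IsChannel ρ → IsChannel σ →
    reduce Φ ρ σ ∈ K}

/-- `K` is normal: it contains every discard-and-prepare channel `ρ ∘ d`. -/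
def IsNormal {A A' : Type} [Fintype A] [Fintype A'] (K : Set (Lin A A')) : Prop :=
  ∀ (d : Lin A Unit) (ρ : Lin Unit A'), IsChannel d → IsChannel ρ → ρ ∘ₗ d ∈ K

/-- `(id_{A'} ⊗ g) ∘ (Φ ⊗ id_Z) ∘ (id_A ⊗ f)` for `f : Y → X ⊗ Z` and `g : X' ⊗ Z → Y'`. -/
def slide {A A' X X' Y Y' Z : Type} (f : Lin Y (X × Z)) (g : Lin (X' × Z) Y')
    (Φ : Lin (A × X) (A' × X')) : Lin (A × Y) (A' × Y') :=
  tensor LinearMap.id g ∘ₗ relabel (Equiv.prodAssoc A' X' Z) ∘ₗ tensor Φ LinearMap.id ∘ₗ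
    relabel (Equiv.prodAssoc A X Z).symm ∘ₗ tensor LinearMap.id f

/-- The rearrangement `⨂ᵢ (Xᵢ ⊗ Zᵢ) ≅ (⨂ᵢ Xᵢ) ⊗ (⨂ᵢ Zᵢ)`. -/
def unzip {n : ℕ} (X Z : Fin n → Type) : (∀ i, X i × Z i) ≃ (∀ i, X i) × (∀ i, Z i) where
  toFun p := (fun i => (p i).1, fun i => (p i).2)
  invFun q := fun i => (q.1 i, q.2 i)
  left_inv _ := rfl
  right_inv _ := rfl

/-- Simultaneous version of `slide` on `Φ : B ⊗ X₁ ⊗ ⋯ ⊗ Xₙ → B' ⊗ X₁' ⊗ ⋯ ⊗ Xₙ'`, for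
`fᵢ : Yᵢ → Xᵢ ⊗ Zᵢ` and `gᵢ : Xᵢ' ⊗ Zᵢ → Yᵢ'`. -/
def multiSlide {n : ℕ} {B B' : Type} {X X' Y Y' Z : Fin n → Sys}
    (f : ∀ i, Lin (Y i) (X i × Z i)) (g : ∀ i, Lin (X' i × Z i) (Y' i))
    (Φ : Lin (B × (∀ i, X i)) (B' × (∀ i, X' i))) : Lin (B × (∀ i, Y i)) (B' × (∀ i, Y' i)) :=
  slide (relabel (unzip (fun i => X i) (fun i => Z i)) ∘ₗ piTensor f)
    (piTensor g ∘ₗ relabel (unzip (fun i => X' i) (fun i => Z i)).symm) Φ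

/-- A multi-input locally-applicable transformation `K₁ … Kₙ → M` on quantum channels.
In `natural`, the channel `ψ i` is the channel obtained from `φ i` by sliding `f i` and `g i`. -/
structure LocallyApplicable {n : ℕ} {A A' : Fin n → Sys} {B B' : Sys}
    (K : ∀ i, Set (Lin (A i) (A' i))) (M : Set (Lin B B')) where
  toFun : ∀ X X' : Fin n → Sys, (∀ i, dExt (K i) (X i) (X' i)) → dExt M (Sys.pi X) (Sys.pi X')
  natural : ∀ (X X' Y Y' Z : Fin n → Sys)
    (f : ∀ i, Lin (Y i) (X i × Z i)) (g : ∀ i, Lin (X' i × Z i) (Y' i)),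
    (∀ i, IsChannel (f i)) → (∀ i, IsChannel (g i)) →
    ∀ (φ : ∀ i, dExt (K i) (X i) (X' i)) (ψ : ∀ i, dExt (K i) (Y i) (Y' i)),
      (∀ i, (ψ i).1 = slide (f i) (g i) (φ i).1) →
      (toFun Y Y' ψ).1 = multiSlide f g (toFun X X' φ).1

/-- `choi φ₁ ⊗ ⋯ ⊗ choi φₙ`, as an operator on
`⨂ᵢ (Aᵢ* ⊗ Aᵢ') ⊗ ((⨂ᵢ Xᵢ*) ⊗ (⨂ᵢ Xᵢ'))`. -/
def choiFamily {n : ℕ} {A A' X X' : Fin n → Sys}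
    (φ : ∀ i, Lin (A i × X i) (A' i × X' i)) :
    Matrix ((∀ i, A i × A' i) × ((∀ i, X i) × (∀ i, X' i)))
      ((∀ i, A i × A' i) × ((∀ i, X i) × (∀ i, X' i))) ℂ :=
  Matrix.of fun p q => ∏ i,
    choi (φ i) (((p.1 i).1, p.2.1 i), ((p.1 i).2, p.2.2 i))
      (((q.1 i).1, q.2.1 i), ((q.1 i).2, q.2.2 i))

/-- The action of `S : ⨂ᵢ (Aᵢ* ⊗ Aᵢ') → B* ⊗ B'` on `φᵢ : Aᵢ ⊗ Xᵢ → Aᵢ' ⊗ Xᵢ'` through compact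
closure: the input wires of the `φᵢ` are bent by cups, `S` is applied to all `Aᵢ* ⊗ Aᵢ'`, and the
wires `B*`, `Xᵢ*` are bent back, giving `B ⊗ X₁ ⊗ ⋯ ⊗ Xₙ → B' ⊗ X₁' ⊗ ⋯ ⊗ Xₙ'`. -/
def applyCP {n : ℕ} {A A' X X' : Fin n → Sys} {B B' : Sys}
    (S : Lin (∀ i, A i × A' i) (B × B'))
    (φ : ∀ i, Lin (A i × X i) (A' i × X' i)) :
    Lin (B × (∀ i, X i)) (B' × (∀ i, X' i)) :=
  unchoi (relabel (Equiv.prodProdProdComm B B' (∀ i, X i) (∀ i, X' i))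
    (ampL S ((∀ i, X i) × (∀ i, X' i)) (choiFamily φ)))

/-- `CP`-supermaps of type `K₁ … Kₙ → M`: completely positive maps `⨂ᵢ (Aᵢ* ⊗ Aᵢ') → B* ⊗ B'` which
send all families of extensions of elements of the `Kᵢ` to extensions of elements of `M`. -/
def CPSupermap {n : ℕ} {A A' : Fin n → Sys} {B B' : Sys}
    (K : ∀ i, Set (Lin (A i) (A' i))) (M : Set (Lin B B')) : Type :=
  {S : Lin (∀ i, A i × A' i) (B × B') // IsCP S ∧
    ∀ (X X' : Fin n → Sys) (φ : ∀ i, Lin (A i × X i) (A' i × X' i)),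
      (∀ i, φ i ∈ dExt (K i) (X i) (X' i)) → applyCP S φ ∈ dExt M (Sys.pi X) (Sys.pi X')}

end QSupermap

/-! Feeding the swap `Aᵢ ⊗ Aᵢ' → Aᵢ' ⊗ Aᵢ` into every slot of `S` turns all wires of `S` into outer
wires: the Choi operator of `S[swaps]` is that of `S` with its indices permuted
(`choi_applyCP_swaps`). Normality makes the swap an admissible input, because its reductions are
discard-and-prepare channels (`swap_mem_dExt`). Hence `S` is determined by its values, and a
transformation `T` has only one candidate: the CP map with `S[swaps] = T(swaps)`.

That `T(φ) = S[φ]` for all `φ` is a teleportation argument. Up to the factor `pᵢ = |Aᵢ|⁻²`, `φᵢ`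
arises from the swap by encoding `φᵢ` in an entangled state and projecting onto the maximally
entangled state (`slide_encode_swap`). The projection is not a channel, so naturality does not apply
to it; it is completed to a measurement whose outcome is kept in a flag. For the resulting family
`Ψ`, naturality gives `T(Ψ) = S[Ψ]`, and selecting success in `S[Ψ]` gives `∏ pᵢ • S[φ]`.

Selecting success in `T(Ψ)` must likewise give `∏ pᵢ • T(φ)`. Convexity makes `T` multi-affine
(`map_mix`), and selection kills every family with an entry flagged as failure
(`postselect_eq_zero`). The failure branch of `Ψᵢ` is not known to be proportional to an admissible
channel. Adding a multiple of `φᵢ` flagged as failure repairs this: the sum is a mixture of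
admissible channels in two ways, with success parts coming from `Ψᵢ` and from `pᵢ • φᵢ`. Comparing
the two expansions of `T` gives the claim. -/

namespace QSupermap

open scoped ComplexOrder

/-! ### Choi operators in coordinates -/

section Choi

variable {A B C R : Type}

theorem apply_eq_sum_choi [Fintype A] [DecidableEq A] (f : Lin A B) (M : Matrix A A ℂ) (b b' : B) :
    f M b b' = ∑ a, ∑ a', M a a' * choi f (a, b) (a', b') := by
  conv_lhs => rw [← unchoi_choi f]
  rfl

theorem choi_injective [Fintype A] [DecidableEq A] {f g : Lin A B} (h : choi f = choi g) :
    f = g := by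
  rw [← unchoi_choi f, h, unchoi_choi]

theorem choi_smul [DecidableEq A] (c : ℂ) (f : Lin A B) : choi (c • f) = c • choi f := rfl

theorem choi_id [DecidableEq A] (a b a' b' : A) :
    choi (LinearMap.id : Lin A A) (a, b) (a', b') =
      (if a = b then 1 else 0) * (if a' = b' then 1 else 0) := by
  by_cases h : a = b <;> simp [choi, h, Matrix.single_apply]

theorem choi_comp [Fintype B] [DecidableEq A] [DecidableEq B] (g : Lin B C) (f : Lin A B)
    (a a' : A) (c c' : C) :
    choi (g ∘ₗ f) (a, c) (a', c') =
      ∑ b, ∑ b', choi f (a, b) (a', b') * choi g (b, c) (b', c') :=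
  apply_eq_sum_choi g _ c c'

theorem ampR_comp (g : Lin B C) (f : Lin A B) : ampR R (g ∘ₗ f) = ampR R g ∘ₗ ampR R f := rfl

theorem ampR_zero : ampR R (0 : Lin A B) = 0 := rfl

theorem choi_ampR_comp_comp {A' X X' Y Y' : Type} [Fintype A] [Fintype X] [Fintype X'] [Fintype Y]
    [DecidableEq A] [DecidableEq X] [DecidableEq X'] [DecidableEq Y]
    (g : Lin X' Y') (Φ : Lin (A × X) (A' × X')) (f : Lin Y X)
    (a a₂ : A) (y y₂ : Y) (a' a₂' : A') (y' y₂' : Y') :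
    choi (ampR A' g ∘ₗ Φ ∘ₗ ampR A f) ((a, y), (a', y')) ((a₂, y₂), (a₂', y₂')) =
      ∑ x', ∑ x₂', (∑ x, ∑ x₂, choi f (y, x) (y₂, x₂) * choi Φ ((a, x), (a', x')) ((a₂, x₂), (a₂', x₂')))
        * choi g (x', y') (x₂', y₂') := by
  change g _ y' y₂' = _
  rw [apply_eq_sum_choi]
  refine Finset.sum_congr rfl fun x' _ => Finset.sum_congr rfl fun x₂' _ => ?_
  congr 1
  change Φ _ _ _ = _
  rw [apply_eq_sum_choi]
  have h : ∀ (a₁ a₃ : A) (x x₂ : X), ampR A f (Matrix.single (a, y) (a₂, y₂) 1) (a₁, x) (a₃, x₂) =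
      (if a = a₁ then 1 else 0) * (if a₂ = a₃ then 1 else 0) * choi f (y, x) (y₂, x₂) := by
    intro a₁ a₃ x x₂
    change f _ _ _ = _
    rw [apply_eq_sum_choi]
    by_cases h : a = a₁ <;> simp [Matrix.single_apply, ite_and, h]
  simp [Fintype.sum_prod_type, h]

theorem choi_slide {A' X X' Y Y' Z : Type} [Fintype A] [Fintype X] [Fintype X'] [Fintype Y]
    [Fintype Z] [DecidableEq Z]
    [DecidableEq A] [DecidableEq X] [DecidableEq X'] [DecidableEq Y]
    (f : Lin Y (X × Z)) (g : Lin (X' × Z) Y') (Φ : Lin (A × X) (A' × X'))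
    (a a₂ : A) (y y₂ : Y) (a' a₂' : A') (y' y₂' : Y') :
    choi (slide f g Φ) ((a, y), (a', y')) ((a₂, y₂), (a₂', y₂')) =
      ∑ x', ∑ z, ∑ x₂', ∑ z₂, (∑ x, ∑ x₂, choi f (y, (x, z)) (y₂, (x₂, z₂)) *
        choi Φ ((a, x), (a', x')) ((a₂, x₂), (a₂', x₂'))) * choi g ((x', z), y') ((x₂', z₂), y₂') := by
  change g _ y' y₂' = _
  rw [apply_eq_sum_choi, Fintype.sum_prod_type]
  refine Finset.sum_congr rfl fun x' _ => Finset.sum_congr rfl fun z _ => ?_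
  rw [Fintype.sum_prod_type]
  refine Finset.sum_congr rfl fun x₂' _ => Finset.sum_congr rfl fun z₂ _ => ?_
  congr 1
  change Φ _ _ _ = _
  rw [apply_eq_sum_choi]
  have h : ∀ (a₁ a₃ : A) (x x₂ : X), ampR A f (Matrix.single (a, y) (a₂, y₂) 1) (a₁, x, z) (a₃, x₂, z₂) =
      (if a = a₁ then 1 else 0) * (if a₂ = a₃ then 1 else 0) * choi f (y, x, z) (y₂, x₂, z₂) := by
    intro a₁ a₃ x x₂
    change f _ _ _ = _
    rw [apply_eq_sum_choi]
    by_cases h : a = a₁ <;> simp [Matrix.single_apply, ite_and, h]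
  -- Reassociation and tensoring with the identity unfold definitionally, so this is `h` again.
  have h' : ∀ (a₁ a₃ : A) (x x₂ : X), (Matrix.of fun p q : A × X =>
      relabel (Equiv.prodAssoc A X Z).symm (tensor LinearMap.id f (Matrix.single (a, y) (a₂, y₂) 1))
        (p, z) (q, z₂)) (a₁, x) (a₃, x₂) =
      (if a = a₁ then 1 else 0) * (if a₂ = a₃ then 1 else 0) * choi f (y, x, z) (y₂, x₂, z₂) := h
  refine Eq.trans ?_ (b := ∑ p : A × X, ∑ q : A × X, ((if a = p.1 then 1 else 0) *
    (if a₂ = q.1 then 1 else 0) * choi f (y, p.2, z) (y₂, q.2, z₂)) *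
      choi Φ (p, (a', x')) (q, (a₂', x₂'))) ?_
  · exact Finset.sum_congr rfl fun p _ => Finset.sum_congr rfl fun q _ =>
      congrArg (· * _) (h' p.1 q.1 p.2 q.2)
  · simp [Fintype.sum_prod_type]

end Choi

/-! ### Complete positivity and channels -/

section CP

variable {A B C R : Type}

theorem IsCP.ampL_posSemidef [Fintype R] {f : Lin A B} (hf : IsCP f)
    {M : Matrix (A × R) (A × R) ℂ} (hM : M.PosSemidef) : (ampL f R M).PosSemidef := by
  let e := Fintype.equivFin R
  have h := (hf _ _ (hM.submatrix (Prod.map id e.symm))).submatrix (Prod.map id e)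
  refine (congrArg Matrix.PosSemidef ?_).mp h
  ext p q
  simp [ampL]

theorem posSemidef_of_vec {ι : Type} [Fintype ι] (v : ι → ℂ) :
    (Matrix.of fun p q => v p * star (v q)).PosSemidef :=
  Matrix.posSemidef_vecMulVec_self_star v

/-- The Choi operator is, up to the order of the factors, `f ⊗ id` applied to the unnormalised
maximally entangled state. -/
theorem IsCP.choi_posSemidef [Fintype A] [DecidableEq A] {f : Lin A B} (hf : IsCP f) :
    (choi f).PosSemidef := by
  have h := (hf.ampL_posSemidef (posSemidef_of_vec
    (fun p : A × A => if p.1 = p.2 then 1 else 0))).submatrix (Prod.swap : A × B → B × A)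
  refine (congrArg Matrix.PosSemidef ?_).mp h
  ext p q
  change f _ p.2 q.2 = f _ p.2 q.2
  refine congrFun (congrFun (congrArg f ?_) _) _
  ext a a'
  by_cases h : a = p.1 <;> simp [Matrix.single_apply, eq_comm, h]

/-- With `V` contracting the two copies of `A`, `(f ⊗ id)(M) = V (M ⊗ choi f) Vᴴ`. -/
theorem isCP_of_choi [Fintype A] [Fintype B] [DecidableEq A] {f : Lin A B}
    (hf : (choi f).PosSemidef) : IsCP f := by
  classical
  intro k M hM
  let V : Matrix (B × Fin k) ((A × Fin k) × (A × B)) ℂ := Matrix.of fun p u =>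
    if u.1.1 = u.2.1 ∧ u.1.2 = p.2 ∧ u.2.2 = p.1 then 1 else 0
  have h := (hM.kronecker hf).mul_mul_conjTranspose_same V
  refine (congrArg Matrix.PosSemidef ?_).mp h
  ext ⟨b, r⟩ ⟨b', r'⟩
  refine Eq.trans ?_ (apply_eq_sum_choi f _ b b').symm
  simp [V, Matrix.mul_apply, Fintype.sum_prod_type, ite_and, apply_ite, Finset.sum_ite_eq]
  rw [Finset.sum_comm]

theorem IsCP.comp {g : Lin B C} {f : Lin A B} (hg : IsCP g) (hf : IsCP f) : IsCP (g ∘ₗ f) :=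
  fun k M hM => hg k _ (hf k M hM)

theorem IsCP.add {f g : Lin A B} (hf : IsCP f) (hg : IsCP g) : IsCP (f + g) :=
  fun k M hM => (hf k M hM).add (hg k M hM)

theorem IsCP.smul {f : Lin A B} (hf : IsCP f) {c : ℂ} (hc : 0 ≤ c) : IsCP (c • f) :=
  fun k M hM => (hf k M hM).smul hc

theorem isCP_id : IsCP (LinearMap.id : Lin A A) := fun _ _ hM => hM

theorem IsCP.ampL [Fintype R] {f : Lin A B} (hf : IsCP f) : IsCP (ampL f R) := by
  intro k M hM
  exact (hf.ampL_posSemidef (R := R × Fin k)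
    (hM.submatrix (Equiv.prodAssoc A R (Fin k)).symm)).submatrix (Equiv.prodAssoc B R (Fin k))

theorem IsCP.ampR [Fintype R] {f : Lin A B} (hf : IsCP f) : IsCP (ampR R f) := by
  intro k M hM
  exact (hf.ampL_posSemidef (R := R × Fin k)
    (hM.submatrix (fun p : A × (R × Fin k) => ((p.2.1, p.1), p.2.2)))).submatrix
      (fun p : (R × B) × Fin k => (p.1.2, (p.1.1, p.2)))

theorem isCP_relabel (e : A ≃ B) : IsCP (relabel e) :=
  fun _ _ hM => hM.submatrix (Prod.map e.symm id)

variable [Fintype A] [Fintype B] [Fintype C] [Fintype R]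

theorem isChannel_id : IsChannel (LinearMap.id : Lin A A) := ⟨isCP_id, fun _ => rfl⟩

theorem IsChannel.comp {g : Lin B C} {f : Lin A B} (hg : IsChannel g) (hf : IsChannel f) :
    IsChannel (g ∘ₗ f) :=
  ⟨hg.1.comp hf.1, fun M => (hg.2 _).trans (hf.2 M)⟩

theorem IsChannel.ampL {f : Lin A B} (hf : IsChannel f) : IsChannel (ampL f R) := by
  refine ⟨hf.1.ampL, fun M => ?_⟩
  simp only [Matrix.trace, Fintype.sum_prod_type_right]
  exact Finset.sum_congr rfl fun r _ => hf.2 (Matrix.of fun a a' => M (a, r) (a', r))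

theorem IsChannel.ampR {f : Lin A B} (hf : IsChannel f) : IsChannel (ampR R f) := by
  refine ⟨hf.1.ampR, fun M => ?_⟩
  simp only [Matrix.trace, Fintype.sum_prod_type]
  exact Finset.sum_congr rfl fun r _ => hf.2 (Matrix.of fun a a' => M (r, a) (r, a'))

theorem isChannel_relabel (e : A ≃ B) : IsChannel (relabel e) :=
  ⟨isCP_relabel e, fun M => Equiv.sum_comp e.symm fun a => M a a⟩

theorem IsChannel.slide {A' X X' Y Y' Z : Type} [Fintype A'] [Fintype X] [Fintype X'] [Fintype Y]
    [Fintype Y'] [Fintype Z] {f : Lin Y (X × Z)} {g : Lin (X' × Z) Y'}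
    {Φ : Lin (A × X) (A' × X')} (hf : IsChannel f) (hg : IsChannel g) (hΦ : IsChannel Φ) :
    IsChannel (slide f g Φ) :=
  hg.ampR.comp ((isChannel_relabel _).comp (hΦ.ampL.comp ((isChannel_relabel _).comp hf.ampR)))

theorem trace_of_choi [DecidableEq A] {f : Lin A B}
    (h : ∀ a a', ∑ b, choi f (a, b) (a', b) = if a = a' then 1 else 0) (M : Matrix A A ℂ) :
    (f M).trace = M.trace := by
  have : (f M).trace = ∑ a, ∑ a', M a a' * ∑ b, choi f (a, b) (a', b) := by
    simp only [Matrix.trace, Matrix.diag, apply_eq_sum_choi f M, Finset.mul_sum]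
    rw [Finset.sum_comm]
    exact Finset.sum_congr rfl fun a _ => Finset.sum_comm
  rw [this]
  simp [h, Matrix.trace]

theorem IsChannel.sum_choi [DecidableEq A] {f : Lin A B} (hf : IsChannel f) (a a' : A) :
    ∑ b, choi f (a, b) (a', b) = if a = a' then 1 else 0 := by
  refine (hf.2 (Matrix.single a a' 1)).trans ?_
  split_ifs with h
  · subst h; simp
  · exact Matrix.trace_single_eq_of_ne _ _ _ h

end CP

/-! ### Tensor products of families of maps -/

section PiTensor

variable {n : ℕ}

theorem choi_piTensor {X Y : Fin n → Type} [∀ i, Fintype (X i)] [∀ i, DecidableEq (X i)]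
    (f : ∀ i, Lin (X i) (Y i)) (p q : (∀ i, X i) × (∀ i, Y i)) :
    choi (piTensor f) p q = ∏ i, choi (f i) (p.1 i, p.2 i) (q.1 i, q.2 i) := by
  rw [piTensor, choi_unchoi]
  rfl

theorem choi_relabel_comp {A B C : Type} [DecidableEq A] (e : B ≃ C) (f : Lin A B) (a a' : A)
    (c c' : C) :
    choi (relabel e ∘ₗ f) (a, c) (a', c') = choi f (a, e.symm c) (a', e.symm c') := rfl

theorem choi_comp_relabel {A B C : Type} [DecidableEq A] [DecidableEq B] (e : A ≃ B) (f : Lin B C)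
    (a a' : A) (c c' : C) :
    choi (f ∘ₗ relabel e) (a, c) (a', c') = choi f (e a, c) (e a', c') := by
  change f (relabel e _) c c' = f _ c c'
  refine congrFun (congrFun (congrArg f ?_) _) _
  exact Matrix.submatrix_single_equiv e.symm e.symm a a' 1

theorem piTensor_comp {X Y W : Fin n → Type} [∀ i, Fintype (X i)] [∀ i, DecidableEq (X i)]
    [∀ i, Fintype (Y i)] [∀ i, DecidableEq (Y i)]
    (g : ∀ i, Lin (Y i) (W i)) (f : ∀ i, Lin (X i) (Y i)) :
    piTensor g ∘ₗ piTensor f = piTensor fun i => g i ∘ₗ f i := by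
  refine choi_injective ?_
  ext ⟨x, w⟩ ⟨x', w'⟩
  simp only [choi_comp, choi_piTensor, Finset.prod_univ_sum, Fintype.piFinset_univ,
    ← Finset.prod_mul_distrib]

theorem piTensor_id {X : Fin n → Type} [∀ i, Fintype (X i)] [∀ i, DecidableEq (X i)] :
    piTensor (fun i => (LinearMap.id : Lin (X i) (X i))) = LinearMap.id := by
  refine choi_injective ?_
  ext ⟨x, w⟩ ⟨x', w'⟩
  rw [choi_piTensor]
  simp only [choi_id, Finset.prod_mul_distrib, Finset.prod_ite_zero, Finset.prod_const_one,
    funext_iff, Finset.mem_univ, true_imp_iff]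

theorem piTensor_eq_zero {X Y : Fin n → Type} [∀ i, Fintype (X i)] [∀ i, DecidableEq (X i)]
    {f : ∀ i, Lin (X i) (Y i)} (i : Fin n) (h : f i = 0) : piTensor f = 0 := by
  refine choi_injective ?_
  ext p q
  rw [choi_piTensor]
  exact Finset.prod_eq_zero (Finset.mem_univ i) (by rw [h]; rfl)

theorem piTensor_sum_smul {ι : Type} [Fintype ι] {X Y : Fin n → Type} [∀ i, Fintype (X i)]
    [∀ i, DecidableEq (X i)] (c : Fin n → ι → ℂ) (f : ∀ i, ι → Lin (X i) (Y i)) :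
    piTensor (fun i => ∑ k, c i k • f i k) =
      ∑ s : Fin n → ι, (∏ i, c i (s i)) • piTensor (fun i => f i (s i)) := by
  have choi_sum : ∀ {κ A B : Type} [Fintype κ] [DecidableEq A] (d : κ → ℂ) (g : κ → Lin A B) p q,
      choi (∑ k, d k • g k) p q = ∑ k, d k * choi (g k) p q := by
    intro κ A B _ _ d g p q
    simp [choi, Matrix.sum_apply]
  refine choi_injective ?_
  ext p q
  rw [choi_piTensor, choi_sum]
  simp only [choi_sum, choi_piTensor, Finset.prod_univ_sum, Fintype.piFinset_univ,
    Finset.prod_mul_distrib]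

end PiTensor

/-! ### The action of a CP map on families, and its naturality -/

section Families

variable {n : ℕ} {A A' X X' Y Y' Z : Fin n → Sys} {B B' : Sys}

theorem choi_multiSlide (f : ∀ i, Lin (Y i) (X i × Z i)) (g : ∀ i, Lin (X' i × Z i) (Y' i))
    (Φ : Lin (B × (∀ i, X i)) (B' × (∀ i, X' i))) (b b₂ : B) (y y₂ : ∀ i, Y i) (b' b₂' : B')
    (y' y₂' : ∀ i, Y' i) :
    choi (multiSlide f g Φ) ((b, y), (b', y')) ((b₂, y₂), (b₂', y₂')) =
      ∑ x' : ∀ i, X' i, ∑ z : ∀ i, Z i, ∑ x₂' : ∀ i, X' i, ∑ z₂ : ∀ i, Z i,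
        (∑ x : ∀ i, X i, ∑ x₂ : ∀ i, X i,
        (∏ i, choi (f i) (y i, (x i, z i)) (y₂ i, (x₂ i, z₂ i))) *
        choi Φ ((b, x), (b', x')) ((b₂, x₂), (b₂', x₂'))) *
        ∏ i, choi (g i) ((x' i, z i), y' i) ((x₂' i, z₂ i), y₂' i) := by
  rw [multiSlide, choi_slide]
  simp only [choi_relabel_comp, choi_comp_relabel, choi_piTensor]
  rfl

theorem choi_applyCP (S : Lin (∀ i, A i × A' i) (B × B'))
    (φ : ∀ i, Lin (A i × X i) (A' i × X' i)) (b b₂ : B) (x x₂ : ∀ i, X i) (b' b₂' : B')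
    (x' x₂' : ∀ i, X' i) :
    choi (applyCP S φ) ((b, x), (b', x')) ((b₂, x₂), (b₂', x₂')) =
      ∑ p, ∑ q, (∏ i, choi (φ i) (((p i).1, x i), ((p i).2, x' i))
        (((q i).1, x₂ i), ((q i).2, x₂' i))) * choi S (p, (b, b')) (q, (b₂, b₂')) := by
  rw [applyCP, choi_unchoi]
  exact apply_eq_sum_choi S _ _ _

/-- `S` touches only the wires `Aᵢ, Aᵢ'`, while `fᵢ, gᵢ` touch only the auxiliary ones. In
coordinates both sides are the same sum in a different order. -/
theorem applyCP_slide (S : Lin (∀ i, A i × A' i) (B × B'))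
    (f : ∀ i, Lin (Y i) (X i × Z i)) (g : ∀ i, Lin (X' i × Z i) (Y' i))
    (φ : ∀ i, Lin (A i × X i) (A' i × X' i)) :
    applyCP S (fun i => slide (f i) (g i) (φ i)) = multiSlide f g (applyCP S φ) := by
  refine choi_injective ?_
  ext ⟨⟨b, y⟩, ⟨b', y'⟩⟩ ⟨⟨b₂, y₂⟩, ⟨b₂', y₂'⟩⟩
  rw [choi_applyCP, choi_multiSlide]
  simp only [choi_slide, choi_applyCP, Finset.prod_univ_sum, Fintype.piFinset_univ,
    Finset.prod_mul_distrib, Finset.sum_mul, Finset.mul_sum]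
  have swap : ∀ {α P Q : Type} [Fintype α] [Fintype P] [Fintype Q] (F : P → Q → α → ℂ),
      (∑ p, ∑ q, ∑ a, F p q a) = ∑ a, ∑ p, ∑ q, F p q a := by
    intro α P Q _ _ _ F
    simp_rw [Finset.sum_comm (s := (Finset.univ : Finset Q))]
    exact Finset.sum_comm
  rw [swap]; refine Finset.sum_congr rfl fun x' _ => ?_
  rw [swap]; refine Finset.sum_congr rfl fun z _ => ?_
  rw [swap]; refine Finset.sum_congr rfl fun x₂' _ => ?_
  rw [swap]; refine Finset.sum_congr rfl fun z₂ _ => ?_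
  rw [swap]; refine Finset.sum_congr rfl fun x _ => ?_
  rw [swap]; refine Finset.sum_congr rfl fun x₂ _ => ?_
  refine Finset.sum_congr rfl fun p _ => Finset.sum_congr rfl fun q _ => ?_
  ring

theorem applyCP_smul (S : Lin (∀ i, A i × A' i) (B × B')) (c : Fin n → ℂ)
    (φ : ∀ i, Lin (A i × X i) (A' i × X' i)) :
    applyCP S (fun i => c i • φ i) = (∏ i, c i) • applyCP S φ := by
  refine choi_injective ?_
  ext ⟨⟨b, y⟩, ⟨b', y'⟩⟩ ⟨⟨b₂, y₂⟩, ⟨b₂', y₂'⟩⟩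
  rw [choi_applyCP, choi_smul, Matrix.smul_apply, choi_applyCP]
  simp only [choi_smul, Matrix.smul_apply, smul_eq_mul, Finset.prod_mul_distrib, Finset.mul_sum,
    mul_assoc]

/-- The one-dimensional system. -/
abbrev Sys.unit : Sys := ⟨Unit⟩

theorem slide_unit {A A' X X' Y Y' : Type} (f : Lin Y X) (g : Lin X' Y')
    (Φ : Lin (A × X) (A' × X')) :
    slide (relabel (Equiv.prodPUnit X).symm ∘ₗ f) (g ∘ₗ relabel (Equiv.prodPUnit X')) Φ =
      ampR A' g ∘ₗ Φ ∘ₗ ampR A f := rfl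

theorem multiSlide_unit (f : ∀ i, Lin (Y i) (X i)) (g : ∀ i, Lin (X' i) (Y' i))
    (Φ : Lin (B × (∀ i, X i)) (B' × (∀ i, X' i))) :
    multiSlide (Z := fun _ => Sys.unit) (fun i => relabel (Equiv.prodPUnit (X i)).symm ∘ₗ f i)
      (fun i => g i ∘ₗ relabel (Equiv.prodPUnit (X' i))) Φ =
      ampR B' (piTensor g) ∘ₗ Φ ∘ₗ ampR B (piTensor f) := by
  refine choi_injective ?_
  ext ⟨⟨b, y⟩, ⟨b', y'⟩⟩ ⟨⟨b₂, y₂⟩, ⟨b₂', y₂'⟩⟩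
  rw [choi_multiSlide]
  refine Eq.trans ?_ (choi_ampR_comp_comp _ _ _ _ _ _ _ _ _ _ _).symm
  simp only [choi_relabel_comp, choi_comp_relabel, choi_piTensor]
  refine Finset.sum_congr rfl fun x' _ => ?_
  rw [Fintype.sum_eq_single (fun _ => ()) fun z h => (h (funext fun _ => rfl)).elim]
  refine Finset.sum_congr rfl fun x₂' _ => ?_
  rw [Fintype.sum_eq_single (fun _ => ()) fun z h => (h (funext fun _ => rfl)).elim]
  rfl

end Families

/-! ### Partial traces, classical flags and classical control -/

section Basic

variable {A B X F : Type}

theorem isCP_zero : IsCP (0 : Lin A B) := fun _ _ _ => Matrix.PosSemidef.zero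

theorem isCP_sum {ι : Type} (s : Finset ι) {f : ι → Lin A B} (hf : ∀ i, IsCP (f i)) :
    IsCP (∑ i ∈ s, f i) :=
  Finset.sum_induction f IsCP (fun _ _ => IsCP.add) isCP_zero fun i _ => hf i

theorem IsCP.posSemidef {f : Lin A B} (hf : IsCP f) {M : Matrix A A ℂ} (hM : M.PosSemidef) :
    (f M).PosSemidef :=
  (hf.ampL_posSemidef (R := Unit) (hM.submatrix Prod.fst)).submatrix fun b => (b, ())

/-- The compression `(id_A ⊗ ⟨x|) M (id_A ⊗ |x⟩)`. -/
def slice (x : X) : Lin (A × X) A where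
  toFun M := M.submatrix (fun a => (a, x)) fun a => (a, x)
  map_add' _ _ := rfl
  map_smul' _ _ := rfl

theorem slice_apply (x : X) (M : Matrix (A × X) (A × X) ℂ) (a a' : A) :
    slice x M a a' = M (a, x) (a', x) := rfl

theorem sum_comp {C ι : Type} (s : Finset ι) (f : ι → Lin B C) (g : Lin A B) :
    (∑ i ∈ s, f i) ∘ₗ g = ∑ i ∈ s, f i ∘ₗ g :=
  LinearMap.ext fun M => by simp [LinearMap.sum_apply]

theorem comp_sum {C ι : Type} (s : Finset ι) (f : Lin B C) (g : ι → Lin A B) :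
    f ∘ₗ (∑ i ∈ s, g i) = ∑ i ∈ s, f ∘ₗ g i :=
  LinearMap.ext fun M => by simp [LinearMap.sum_apply]

theorem isCP_slice (x : X) : IsCP (slice x : Lin (A × X) A) :=
  fun k _ hM => hM.submatrix fun p : A × Fin k => ((p.1, x), p.2)

/-- The partial trace over the right factor. -/
def discardR (A X : Type) [Fintype X] : Lin (A × X) A := ∑ x, slice x

theorem discardR_apply [Fintype X] (M : Matrix (A × X) (A × X) ℂ) (a a' : A) :
    discardR A X M a a' = ∑ x, M (a, x) (a', x) := by
  simp [discardR, LinearMap.sum_apply, Matrix.sum_apply, slice_apply]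

theorem isChannel_discardR [Fintype A] [Fintype X] : IsChannel (discardR A X) :=
  ⟨isCP_sum _ isCP_slice, fun M => by
    simp [Matrix.trace, discardR_apply, Fintype.sum_prod_type]⟩

/-- Adjoin a system in the state `R`. -/
def attach (A : Type) (R : Matrix X X ℂ) : Lin A (A × X) where
  toFun M := Matrix.kroneckerMap (· * ·) M R
  map_add' M N := Matrix.add_kronecker M N R
  map_smul' c M := Matrix.smul_kronecker c M R

theorem attach_apply (R : Matrix X X ℂ) (M : Matrix A A ℂ) (p q : A × X) :
    attach A R M p q = M p.1 q.1 * R p.2 q.2 := rfl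

theorem isCP_attach [Fintype A] [Fintype X] {R : Matrix X X ℂ} (hR : R.PosSemidef) :
    IsCP (attach A R) := fun k _ hM =>
  (hM.kronecker hR).submatrix fun p : (A × X) × Fin k => ((p.1.1, p.2), p.1.2)

theorem isChannel_attach [Fintype A] [Fintype X] {R : Matrix X X ℂ} (hR : R.PosSemidef)
    (htr : R.trace = 1) : IsChannel (attach A R) :=
  ⟨isCP_attach hR, fun M => (Matrix.trace_kronecker M R).trans (by rw [htr, mul_one])⟩

/-- Adjoin a system in the basis state `s`. -/
def flag (X : Type) [DecidableEq F] (s : F) : Lin X (X × F) := attach X (Matrix.single s s 1)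

theorem posSemidef_single [Fintype F] [DecidableEq F] (s : F) :
    (Matrix.single s s (1 : ℂ)).PosSemidef := by
  rw [← Matrix.diagonal_single]
  exact Matrix.PosSemidef.diagonal fun i => by
    by_cases h : i = s
    · subst h; simp
    · simp [Pi.single_eq_of_ne h]

theorem isChannel_flag [Fintype X] [Fintype F] [DecidableEq F] (s : F) :
    IsChannel (flag X s) :=
  isChannel_attach (posSemidef_single s) (by simp)

theorem slice_comp_flag [DecidableEq F] (q s : F) :
    slice q ∘ₗ flag X s = if q = s then LinearMap.id else 0 := by
  refine LinearMap.ext fun M => ?_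
  ext x x'
  by_cases h : q = s
  · subst h; simp [slice_apply, flag, attach_apply]
  · simp [slice_apply, flag, attach_apply, h, Ne.symm h]

theorem discardR_comp_flag [Fintype F] [DecidableEq F] (s : F) :
    discardR X F ∘ₗ flag X s = LinearMap.id := by
  rw [discardR, sum_comp]
  simp [slice_comp_flag]

/-- Convexity is stated over `ℝ`, whereas traces and weights are complex. -/
theorem real_smul_eq (r : ℝ) (f : Lin A B) : r • f = (r : ℂ) • f :=
  LinearMap.ext fun _ => Matrix.ext fun _ _ => Complex.real_smul

/-- The channel that applies `Φ q` conditionally on the value `q` of a classical control. -/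
def ctrl {A' X' : Type} [Fintype F] (Φ : F → Lin (A × X) (A' × X')) : Lin (A × (X × F)) (A' × X') :=
  ∑ q, Φ q ∘ₗ ampR A (slice q)

theorem ctrl_comp_flag {A' X' : Type} [Fintype F] [DecidableEq F] (Φ : F → Lin (A × X) (A' × X'))
    (s : F) : ctrl Φ ∘ₗ ampR A (flag X s) = Φ s := by
  rw [ctrl, sum_comp, Fintype.sum_eq_single s]
  · rw [LinearMap.comp_assoc, ← ampR_comp, slice_comp_flag, if_pos rfl]
    rfl
  · intro q hq
    rw [LinearMap.comp_assoc, ← ampR_comp, slice_comp_flag, if_neg hq, ampR_zero,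
      LinearMap.comp_zero]

end Basic

/-! ### Dilation extensions -/

section Extensions

variable {A A' X X' : Type} [Fintype X']

/-- `Φ` with the state `R` inserted and the auxiliary output discarded. -/
def red (Φ : Lin (A × X) (A' × X')) (R : Matrix X X ℂ) : Lin A A' :=
  discardR A' X' ∘ₗ Φ ∘ₗ attach A R

theorem red_apply (Φ : Lin (A × X) (A' × X')) (R : Matrix X X ℂ) (M : Matrix A A ℂ) (a a' : A') :
    red Φ R M a a' = ∑ x, Φ (attach A R M) (a, x) (a', x) :=
  discardR_apply _ _ _

/-- The trace is the only trace-preserving map to the unit system, so the choice of effect is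
immaterial. -/
theorem reduce_eq_red (Φ : Lin (A × X) (A' × X')) (ρ : Lin Unit X) {σ : Lin X' Unit}
    (hσ : ∀ M, (σ M).trace = M.trace) : reduce Φ ρ σ = red Φ (ρ 1) := by
  refine LinearMap.ext fun M => ?_
  ext a a'
  rw [red_apply]
  have h : ∀ N, σ N () () = N.trace := fun N => by rw [← hσ N]; simp [Matrix.trace]
  refine (h _).trans ?_
  have h' : ampR A ρ (relabel (Equiv.prodPUnit A).symm M) = attach A (ρ 1) M := by
    ext p q
    change ρ (Matrix.of fun _ _ => M p.1 q.1) p.2 q.2 = _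
    rw [attach_apply, ← smul_eq_mul, ← Matrix.smul_apply, ← map_smul]
    refine congrFun (congrFun (congrArg ρ ?_) _) _
    ext
    simp
  rw [← h']
  rfl

theorem red_smul (Φ : Lin (A × X) (A' × X')) (c : ℂ) (R : Matrix X X ℂ) :
    red Φ (c • R) = c • red Φ R := by
  have : attach A (c • R) = c • attach A R :=
    LinearMap.ext fun M => Matrix.kronecker_smul c M R
  rw [red, this, LinearMap.comp_smul, LinearMap.comp_smul]
  rfl

/-- The preparation of the state `R`. -/
def prepare (R : Matrix X X ℂ) : Lin Unit X :=
  relabel (Equiv.punitProd X) ∘ₗ attach Unit R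

/-- The trace, as a map to the unit system. -/
def discard (X : Type) [Fintype X] : Lin X Unit :=
  discardR Unit X ∘ₗ relabel (Equiv.punitProd X).symm

theorem prepare_apply (R : Matrix X X ℂ) (M : Matrix Unit Unit ℂ) :
    prepare R M = M () () • R := rfl

theorem discard_apply [Fintype X] (M : Matrix X X ℂ) (u v : Unit) : discard X M u v = M.trace :=
  discardR_apply _ _ _

/-- Once its output is discarded, `g` becomes the trace on `X' ⊗ Z`. What `Φ` then receives is the
marginal of `f R` on `X`. -/
theorem red_slide {Y Y' Z : Type} [Fintype Y'] [Fintype Z] (f : Lin Y (X × Z))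
    {g : Lin (X' × Z) Y'} (hg : ∀ M, (g M).trace = M.trace) (Φ : Lin (A × X) (A' × X'))
    (R : Matrix Y Y ℂ) : red (slide f g Φ) R = red Φ (discardR X Z (f R)) := by
  refine LinearMap.ext fun M => ?_
  ext a a'
  rw [red_apply, red_apply]
  let N := relabel (Equiv.prodAssoc A' X' Z) (ampL Φ Z
    (relabel (Equiv.prodAssoc A X Z).symm (ampR A f (attach A R M))))
  refine (hg (Matrix.of fun p q => N (a, p) (a', q))).trans ?_
  have h : ∀ z, Matrix.of (fun p q : A × X =>
      ampR A f (attach A R M) (p.1, p.2, z) (q.1, q.2, z)) =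
      attach A (slice z (f R)) M := by
    intro z
    ext p q
    change f (M p.1 q.1 • R) _ _ = _
    rw [map_smul]
    rfl
  have h' : attach A (discardR X Z (f R)) M = ∑ z, attach A (slice z (f R)) M := by
    ext p q
    simp [attach_apply, Matrix.sum_apply, discardR_apply, Finset.mul_sum, slice_apply]
  rw [h', Matrix.trace, Fintype.sum_prod_type]
  refine Finset.sum_congr rfl fun x _ => ?_
  rw [map_sum, Matrix.sum_apply]
  refine Finset.sum_congr rfl fun z _ => ?_
  rw [← h z]
  rfl

theorem red_ctrl {F : Type} [Fintype F] (Φ : F → Lin (A × X) (A' × X'))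
    (R : Matrix (X × F) (X × F) ℂ) : red (ctrl Φ) R = ∑ q, red (Φ q) (slice q R) := by
  rw [red, ctrl, sum_comp, comp_sum]
  rfl

variable [Fintype A] [Fintype A'] [Fintype X]

theorem isChannel_prepare {R : Matrix X X ℂ} (hR : R.PosSemidef) (htr : R.trace = 1) :
    IsChannel (prepare R) :=
  (isChannel_relabel _).comp (isChannel_attach hR htr)

theorem isChannel_discard : IsChannel (discard X) :=
  isChannel_discardR.comp (isChannel_relabel _)

theorem mem_dExt_iff {K : Set (Lin A A')} {Φ : Lin (A × X) (A' × X')} :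
    Φ ∈ dExt K X X' ↔ IsChannel Φ ∧
      ∀ R : Matrix X X ℂ, R.PosSemidef → R.trace = 1 → red Φ R ∈ K := by
  refine and_congr_right fun _ => ⟨fun h R hR htr => ?_, fun h ρ σ hρ hσ => ?_⟩
  · have := h _ _ (isChannel_prepare hR htr) isChannel_discard
    rwa [reduce_eq_red _ _ isChannel_discard.2, prepare_apply, Matrix.one_apply_eq, one_smul]
      at this
  · rw [reduce_eq_red _ _ hσ.2]
    exact h _ (hρ.1.posSemidef Matrix.PosSemidef.one) (by rw [hρ.2]; simp)

theorem slide_mem_dExt {K : Set (Lin A A')} {Y Y' Z : Type} [Fintype Y] [Fintype Y'] [Fintype Z]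
    {f : Lin Y (X × Z)} {g : Lin (X' × Z) Y'} {Φ : Lin (A × X) (A' × X')}
    (hf : IsChannel f) (hg : IsChannel g) (hΦ : Φ ∈ dExt K X X') :
    slide f g Φ ∈ dExt K Y Y' := by
  rw [mem_dExt_iff] at hΦ ⊢
  refine ⟨hf.slide hg hΦ.1, fun R hR htr => ?_⟩
  rw [red_slide f hg.2]
  refine hΦ.2 _ (isChannel_discardR.1.posSemidef (hf.1.posSemidef hR)) ?_
  rw [isChannel_discardR.2, hf.2, htr]

theorem comp_mem_dExt {K : Set (Lin A A')} {Y Y' : Type} [Fintype Y] [Fintype Y']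
    {f : Lin Y X} {g : Lin X' Y'} {Φ : Lin (A × X) (A' × X')}
    (hf : IsChannel f) (hg : IsChannel g) (hΦ : Φ ∈ dExt K X X') :
    ampR A' g ∘ₗ Φ ∘ₗ ampR A f ∈ dExt K Y Y' :=
  slide_unit f g Φ ▸ slide_mem_dExt ((isChannel_relabel (Equiv.prodPUnit X).symm).comp hf)
    (hg.comp (isChannel_relabel (Equiv.prodPUnit X'))) hΦ

theorem comp_left_mem_dExt {K : Set (Lin A A')} {Y' : Type} [Fintype Y']
    {g : Lin X' Y'} {Φ : Lin (A × X) (A' × X')} (hg : IsChannel g) (hΦ : Φ ∈ dExt K X X') :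
    ampR A' g ∘ₗ Φ ∈ dExt K X Y' :=
  comp_mem_dExt (f := LinearMap.id) isChannel_id hg hΦ

/-- With `R` inserted and the output `A` discarded, the swap becomes `M ↦ tr(M) • R`, a
discard-and-prepare channel. -/
theorem swap_mem_dExt {K : Set (Lin A A')} (hK : IsNormal K) :
    relabel (Equiv.prodComm A A') ∈ dExt K A' A := by
  refine mem_dExt_iff.mpr ⟨isChannel_relabel _, fun R hR htr => ?_⟩
  convert hK _ _ isChannel_discard (isChannel_prepare hR htr) using 1
  refine LinearMap.ext fun M => ?_
  ext a a'
  rw [red_apply]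
  change ∑ x, M x x * R a a' = (discard A M () ()) * R a a'
  rw [discard_apply, Matrix.trace, Finset.sum_mul]
  rfl

theorem exists_red_eq_smul [Nonempty X] {K : Set (Lin A A')} {Φ : Lin (A × X) (A' × X')}
    (hΦ : Φ ∈ dExt K X X') {R : Matrix X X ℂ} (hR : R.PosSemidef) :
    ∃ k ∈ K, red Φ R = R.trace.re • k := by
  classical
  rw [mem_dExt_iff] at hΦ
  have him : (R.trace.re : ℂ) = R.trace :=
    Complex.ext rfl (Complex.nonneg_iff.mp hR.trace_nonneg).2
  by_cases h : R.trace = 0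
  -- Here `R = 0`, so any element of `K` serves; a basis state supplies one.
  · obtain ⟨x⟩ := ‹Nonempty X›
    refine ⟨_, hΦ.2 _ (posSemidef_single x) (by simp), ?_⟩
    rw [h, Complex.zero_re, zero_smul, hR.trace_eq_zero_iff.mp h, ← zero_smul ℂ (0 : Matrix X X ℂ),
      red_smul, zero_smul]
  · refine ⟨_, hΦ.2 (R.trace⁻¹ • R) (hR.smul (inv_nonneg.mpr hR.trace_nonneg)) ?_, ?_⟩
    · rw [Matrix.trace_smul, smul_eq_mul, inv_mul_cancel₀ h]
    · rw [real_smul_eq, him, ← red_smul, smul_smul, mul_inv_cancel₀ h, one_smul]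

theorem isChannel_ctrl {F : Type} [Fintype F] {Φ : F → Lin (A × X) (A' × X')}
    (hΦ : ∀ q, IsChannel (Φ q)) : IsChannel (ctrl Φ) := by
  refine ⟨isCP_sum _ fun q => (hΦ q).1.comp (isCP_slice q).ampR, fun M => ?_⟩
  rw [ctrl, LinearMap.sum_apply, Matrix.trace_sum]
  simp only [LinearMap.comp_apply, (hΦ _).2]
  simp only [Matrix.trace, Fintype.sum_prod_type]
  rw [Finset.sum_comm]
  refine Finset.sum_congr rfl fun a _ => ?_
  rw [Finset.sum_comm]
  rfl

/-- A state on `X ⊗ F` is seen only through its blocks `slice q R`. The reduction is thus a convex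
combination of elements of `K` whose weights are the traces of the blocks. -/
theorem ctrl_mem_dExt {F : Type} [Fintype F] [Nonempty X] {K : Set (Lin A A')} (hK : Convex ℝ K)
    {Φ : F → Lin (A × X) (A' × X')} (hΦ : ∀ q, Φ q ∈ dExt K X X') :
    ctrl Φ ∈ dExt K (X × F) X' := by
  refine mem_dExt_iff.mpr ⟨isChannel_ctrl fun q => (hΦ q).1, fun R hR htr => ?_⟩
  have hs : ∀ q, (slice q R : Matrix X X ℂ).PosSemidef := fun q => (isCP_slice q).posSemidef hR
  choose k hk hkr using fun q => exists_red_eq_smul (hΦ q) (hs q)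
  rw [red_ctrl]
  simp only [hkr]
  refine hK.sum_mem (fun q _ => (Complex.nonneg_iff.mp (hs q).trace_nonneg).1) ?_ fun q _ => hk q
  rw [← Complex.re_sum, ← Matrix.trace_sum]
  have : ∑ q, slice q R = discardR X F R := by rw [discardR, LinearMap.sum_apply]
  rw [this, isChannel_discardR.2, htr, Complex.one_re]

end Extensions

/-! ### Teleportation through the swap -/

section Teleport

variable {A A' X X' F : Type}

/-- Evaluate the functional `N ↦ ∑ N f f' * P f f'` on the right factor. -/
def effect [Fintype F] (X : Type) (P : Matrix F F ℂ) : Lin (X × F) X :=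
  ∑ f, ∑ f', P f f' •
    { toFun := fun M => M.submatrix (fun x => (x, f)) fun x => (x, f')
      map_add' := fun _ _ => rfl
      map_smul' := fun _ _ => rfl }

theorem effect_apply [Fintype F] (P : Matrix F F ℂ) (M : Matrix (X × F) (X × F) ℂ) (x x' : X) :
    effect X P M x x' = ∑ f, ∑ f', P f f' * M (x, f) (x', f') := by
  simp [effect, LinearMap.sum_apply, Matrix.sum_apply]
  rfl

theorem effect_add [Fintype F] (P Q : Matrix F F ℂ) :
    effect X (P + Q) = effect X P + effect X Q := by
  simp [effect, add_smul, Finset.sum_add_distrib]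

theorem effect_one [Fintype F] [DecidableEq F] :
    effect X (1 : Matrix F F ℂ) = discardR X F := by
  refine LinearMap.ext fun M => ?_
  ext x x'
  simp [effect_apply, discardR_apply, Matrix.one_apply]

theorem choi_effect [Fintype F] [DecidableEq F] [DecidableEq X] (P : Matrix F F ℂ) (x x₂ y y₂ : X)
    (f f₂ : F) : choi (effect X P) ((x, f), y) ((x₂, f₂), y₂) =
      (if x = y then 1 else 0) * (if x₂ = y₂ then 1 else 0) * P f f₂ := by
  rw [choi, Matrix.of_apply, effect_apply, Fintype.sum_eq_single f, Fintype.sum_eq_single f₂]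
  · by_cases h : x = y <;> simp [Matrix.single_apply, h]
  · intro f' hf'
    simp [hf'.symm]
  · intro f' hf'
    simp [hf'.symm]

theorem isCP_effect [Fintype F] [Fintype X] {P : Matrix F F ℂ} (hP : P.PosSemidef) :
    IsCP (effect X P) := by
  classical
  refine isCP_of_choi ?_
  have h := ((posSemidef_of_vec (fun p : X × X => if p.1 = p.2 then (1 : ℂ) else 0)).kronecker
    hP).submatrix (fun p : (X × F) × X => ((p.1.1, p.2), p.1.2))
  refine (congrArg Matrix.PosSemidef ?_).mp h
  ext ⟨⟨x, f⟩, y⟩ ⟨⟨x₂, f₂⟩, y₂⟩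
  rw [choi_effect]
  simp [apply_ite (star : ℂ → ℂ)]

/-- The projection onto the maximally entangled state. -/
noncomputable def bellProj (A : Type) [Fintype A] [DecidableEq A] : Matrix (A × A) (A × A) ℂ :=
  (Fintype.card A : ℂ)⁻¹ • Matrix.of fun p q =>
    (if p.1 = p.2 then 1 else 0) * star (if q.1 = q.2 then 1 else 0)

theorem choi_swap [DecidableEq A] [DecidableEq A'] (a a₂ y' y₂' : A) (a' a₂' y y₂ : A') :
    choi (relabel (Equiv.prodComm A A')) ((a, y), (a', y')) ((a₂, y₂), (a₂', y₂')) =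
      ((if a = y' then 1 else 0) * (if y = a' then 1 else 0)) *
        ((if a₂ = y₂' then 1 else 0) * (if y₂ = a₂' then 1 else 0)) := by
  change (Matrix.single (a, y) (a₂, y₂) (1 : ℂ)) (y', a') (y₂', a₂') = _
  by_cases h : a = y' <;> by_cases h' : y = a' <;> by_cases h'' : a₂ = y₂' <;>
    simp [Matrix.single_apply, h, h', h'']

variable [Fintype A] [DecidableEq A]

theorem bellProj_apply (a b a' b' : A) : bellProj A (a, b) (a', b') =
    (Fintype.card A : ℂ)⁻¹ * ((if a = b then 1 else 0) * (if a' = b' then 1 else 0)) := by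
  simp [bellProj, apply_ite (star : ℂ → ℂ)]

theorem posSemidef_bellProj : (bellProj A).PosSemidef :=
  (posSemidef_of_vec _).smul (by positivity)

theorem bellProj_mul_self [Nonempty A] : bellProj A * bellProj A = bellProj A := by
  ext ⟨a, b⟩ ⟨a', b'⟩
  have : (Fintype.card A : ℂ) ≠ 0 := by simp
  simp [Matrix.mul_apply, Fintype.sum_prod_type, bellProj_apply]

/-- For a projection `P`, `1 - P = (1 - P)ᴴ (1 - P)`. -/
theorem posSemidef_one_sub_bellProj [Nonempty A] : (1 - bellProj A).PosSemidef := by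
  have h := Matrix.posSemidef_conjTranspose_mul_self (1 - bellProj A)
  rwa [Matrix.conjTranspose_sub, Matrix.conjTranspose_one, posSemidef_bellProj.1.eq, mul_sub,
    sub_mul, sub_mul, bellProj_mul_self, one_mul, mul_one, one_mul, sub_self, sub_zero] at h

/-- The regrouping `A ⊗ (X ⊗ A) ≅ X ⊗ (A ⊗ A)`. -/
def regroup (A X : Type) : A × (X × A) ≃ X × (A × A) where
  toFun p := (p.2.1, p.1, p.2.2)
  invFun p := (p.2.1, p.1, p.2.2)
  left_inv _ := rfl
  right_inv _ := rfl

/-- The binary measurement of the two copies of `A` for the maximally entangled state; the outcome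
`false` flags success. -/
noncomputable def bellMeasure (A X : Type) [Fintype A] [DecidableEq A] : Lin (A × (X × A)) (X × Bool) :=
  flag X false ∘ₗ effect X (bellProj A) ∘ₗ relabel (regroup A X) +
    flag X true ∘ₗ effect X (1 - bellProj A) ∘ₗ relabel (regroup A X)

theorem isChannel_bellMeasure [Nonempty A] [Fintype X] : IsChannel (bellMeasure A X) := by
  have hf := fun b => isChannel_flag (X := X) (F := Bool) b
  refine ⟨((hf _).1.comp ((isCP_effect posSemidef_bellProj).comp (isCP_relabel _))).add
    ((hf _).1.comp ((isCP_effect posSemidef_one_sub_bellProj).comp (isCP_relabel _))),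
    fun M => ?_⟩
  rw [bellMeasure, LinearMap.add_apply, Matrix.trace_add]
  simp only [LinearMap.comp_apply, (hf _).2]
  rw [← Matrix.trace_add, ← LinearMap.add_apply, ← effect_add, add_sub_cancel, effect_one,
    isChannel_discardR.2, (isChannel_relabel _).2]

variable [Fintype X] [DecidableEq X]

/-- Apply `φ` to one half of a maximally entangled state on `A ⊗ A`. -/
noncomputable def encode (φ : Lin (A × X) (A' × X')) : Lin X (A' × (X' × A)) :=
  (Fintype.card A : ℂ)⁻¹ • unchoi ((choi φ).submatrix
    (fun p => ((p.2.2.2, p.1), (p.2.1, p.2.2.1))) fun p => ((p.2.2.2, p.1), (p.2.1, p.2.2.1)))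

theorem choi_encode (φ : Lin (A × X) (A' × X')) (x x₂ : X) (a' a₂' : A') (x' x₂' : X') (a a₂ : A) :
    choi (encode φ) (x, (a', (x', a))) (x₂, (a₂', (x₂', a₂))) =
      (Fintype.card A : ℂ)⁻¹ * choi φ ((a, x), (a', x')) ((a₂, x₂), (a₂', x₂')) := by
  rw [encode, choi_smul, choi_unchoi]
  rfl

variable [Fintype X'] [Fintype A']

theorem isChannel_encode [Nonempty A] {φ : Lin (A × X) (A' × X')} (hφ : IsChannel φ) :
    IsChannel (encode φ) := by
  refine ⟨IsCP.smul (isCP_of_choi ?_) (by positivity), trace_of_choi fun x x₂ => ?_⟩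
  · rw [choi_unchoi]
    exact hφ.1.choi_posSemidef.submatrix _
  · have h := fun a => hφ.sum_choi (a, x) (a, x₂)
    simp only [Fintype.sum_prod_type] at h ⊢
    simp only [choi_encode, ← Finset.mul_sum]
    have hs : ∀ G : A' → X' → A → ℂ,
        ∑ a', ∑ x', ∑ a, G a' x' a = ∑ a, ∑ a', ∑ x', G a' x' a := by
      intro G
      rw [Finset.sum_comm]
      simp_rw [Finset.sum_comm (s := (Finset.univ : Finset A')) (t := (Finset.univ : Finset A))]
      rw [Finset.sum_comm]
      exact Finset.sum_congr rfl fun a _ => Finset.sum_comm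
    rw [hs]
    simp only [h]
    split_ifs with hx <;> simp_all

/-- The swap emits the `A'` half of the encoded state and hands the input `A` to the effect, which
teleports it into `φ`. One factor `|A|⁻¹` normalises the entangled state, the other the projection.
-/
theorem slide_encode_swap [DecidableEq X'] [DecidableEq A'] (φ : Lin (A × X) (A' × X')) :
    slide (encode φ) (effect X' (bellProj A) ∘ₗ relabel (regroup A X'))
      (relabel (Equiv.prodComm A A')) = ((Fintype.card A : ℂ)⁻¹ ^ 2) • φ := by
  refine choi_injective ?_
  ext ⟨⟨a, x⟩, ⟨a', x'⟩⟩ ⟨⟨a₂, x₂⟩, ⟨a₂', x₂'⟩⟩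
  rw [choi_slide]
  simp only [choi_comp_relabel, Fintype.sum_prod_type, choi_encode, choi_swap, regroup,
    Equiv.coe_fn_mk, choi_effect, bellProj_apply, choi_smul, Matrix.smul_apply]
  simp
  ring

end Teleport

/-! ### Mixtures as classically controlled channels -/

section Linearity

variable {A A' X X' Y Y' W Z : Type}

theorem slide_add_right (f : Lin Y (X × Z)) (g g' : Lin (X' × Z) Y') (Φ : Lin (A × X) (A' × X')) :
    slide f (g + g') Φ = slide f g Φ + slide f g' Φ := rfl

/-- Adjoining a classical state with weights `w` is a channel. -/
theorem isChannel_sum_flag {X F : Type} [Fintype X] [Fintype F] [DecidableEq F] {w : F → ℂ}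
    (hw : ∀ q, 0 ≤ w q) (hw1 : ∑ q, w q = 1) : IsChannel (∑ q, w q • flag X q) := by
  refine ⟨isCP_sum _ fun q => (isChannel_flag q).1.smul (hw q), fun M => ?_⟩
  simp [LinearMap.sum_apply, Matrix.trace_sum, (isChannel_flag _).2, ← Finset.sum_mul, hw1]

theorem mix_eq {X' : Type} {A A' X F : Type} [Fintype F] [DecidableEq F] (w : F → ℂ)
    (Φ : F → Lin (A × X) (A' × X')) :
    ∑ q, w q • Φ q = ctrl Φ ∘ₗ ampR A (∑ q, w q • flag X q) := by
  have : ampR A (∑ q, w q • flag X q) = ∑ q, w q • ampR A (flag X q) := by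
    refine LinearMap.ext fun N => ?_
    ext p q
    simp only [LinearMap.sum_apply, Matrix.sum_apply]
    change (∑ q, w q • flag X q : Lin X (X × F)) _ _ _ = _
    simp only [LinearMap.sum_apply, Matrix.sum_apply]
    rfl
  rw [this, comp_sum]
  simp only [LinearMap.comp_smul, ctrl_comp_flag]

theorem mix_mem_dExt {A A' X X' F : Type} [Fintype A] [Fintype A'] [Fintype X] [Fintype X']
    [Nonempty X] [Fintype F] [DecidableEq F] {K : Set (Lin A A')} (hK : Convex ℝ K) {w : F → ℂ}
    (hw : ∀ q, 0 ≤ w q) (hw1 : ∑ q, w q = 1) {Φ : F → Lin (A × X) (A' × X')}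
    (hΦ : ∀ q, Φ q ∈ dExt K X X') : ∑ q, w q • Φ q ∈ dExt K X X' := by
  rw [mix_eq]
  exact comp_mem_dExt (g := LinearMap.id) (isChannel_sum_flag hw hw1) isChannel_id
    (ctrl_mem_dExt hK hΦ)

end Linearity

/-! ### Recovering a CP map from its value at the swaps -/

variable {n : ℕ} {A A' X X' Y Y' : Fin n → Sys} {B B' : Sys}

/-- The family of swaps `Aᵢ ⊗ Aᵢ' → Aᵢ' ⊗ Aᵢ`. -/
def swaps (A A' : Fin n → Sys) (i : Fin n) : Lin (A i × A' i) (A' i × A i) :=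
  relabel (Equiv.prodComm (A i) (A' i))

theorem choi_applyCP_swaps (S : Lin (∀ i, A i × A' i) (B × B')) (b b₂ : B) (x x₂ : ∀ i, A' i)
    (b' b₂' : B') (x' x₂' : ∀ i, A i) :
    choi (applyCP S (swaps A A')) ((b, x), (b', x')) ((b₂, x₂), (b₂', x₂')) =
      choi S (fun i => (x' i, x i), (b, b')) (fun i => (x₂' i, x₂ i), (b₂, b₂')) := by
  rw [choi_applyCP, Fintype.sum_eq_single (fun i => (x' i, x i)),
    Fintype.sum_eq_single (fun i => (x₂' i, x₂ i))]
  · simp [swaps, choi_swap]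
  · intro q hq
    obtain ⟨i, hi⟩ := Function.ne_iff.mp hq
    rw [Finset.prod_eq_zero (Finset.mem_univ i), zero_mul]
    simp only [swaps, choi_swap]
    have : ¬((q i).1 = x₂' i ∧ x₂ i = (q i).2) := fun h => hi (Prod.ext h.1 h.2.symm)
    by_cases h : (q i).1 = x₂' i <;> simp_all
  · intro q hq
    obtain ⟨i, hi⟩ := Function.ne_iff.mp hq
    refine Finset.sum_eq_zero fun p _ => ?_
    rw [Finset.prod_eq_zero (Finset.mem_univ i), zero_mul]
    simp only [swaps, choi_swap]
    have : ¬((q i).1 = x' i ∧ x i = (q i).2) := fun h => hi (Prod.ext h.1 h.2.symm)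
    by_cases h : (q i).1 = x' i <;> simp_all

theorem applyCP_swaps_injective {S S' : Lin (∀ i, A i × A' i) (B × B')}
    (h : applyCP S (swaps A A') = applyCP S' (swaps A A')) : S = S' := by
  refine choi_injective ?_
  ext ⟨p, b, b'⟩ ⟨q, b₂, b₂'⟩
  have h' := congrFun (congrFun (congrArg choi h) ((b, fun i => (p i).2), (b', fun i => (p i).1)))
    ((b₂, fun i => (q i).2), (b₂', fun i => (q i).1))
  rwa [choi_applyCP_swaps, choi_applyCP_swaps] at h'

theorem exists_applyCP_swaps_eq {Φ : Lin (B × (∀ i, A' i)) (B' × (∀ i, A i))} (hΦ : IsCP Φ) :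
    ∃ S : Lin (∀ i, A i × A' i) (B × B'), IsCP S ∧ applyCP S (swaps A A') = Φ := by
  let e : (∀ i, A i × A' i) × (B × B') → (B × (∀ i, A' i)) × (B' × (∀ i, A i)) :=
    fun p => ((p.2.1, fun i => (p.1 i).2), (p.2.2, fun i => (p.1 i).1))
  refine ⟨unchoi ((choi Φ).submatrix e e), isCP_of_choi ?_, choi_injective ?_⟩
  · rw [choi_unchoi]
    exact hΦ.choi_posSemidef.submatrix e
  · ext ⟨⟨b, y⟩, ⟨b', y'⟩⟩ ⟨⟨b₂, y₂⟩, ⟨b₂', y₂'⟩⟩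
    rw [choi_applyCP_swaps, choi_unchoi]
    rfl

/-- No channel hypothesis is needed for CP maps, so `g` may be a postselection. -/
theorem applyCP_comp (S : Lin (∀ i, A i × A' i) (B × B')) (f : ∀ i, Lin (Y i) (X i))
    (g : ∀ i, Lin (X' i) (Y' i)) (φ : ∀ i, Lin (A i × X i) (A' i × X' i)) :
    applyCP S (fun i => ampR (A' i) (g i) ∘ₗ φ i ∘ₗ ampR (A i) (f i)) =
      ampR B' (piTensor g) ∘ₗ applyCP S φ ∘ₗ ampR B (piTensor f) := by
  rw [← multiSlide_unit, ← applyCP_slide]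
  rfl

/-- The system `X ⊗ ℂ²`. -/
abbrev Sys.flagged (X : Sys) : Sys := ⟨X × Bool⟩

/-- The projection of all flags onto the outcome `false`. -/
noncomputable def postselect (X : Fin n → Sys) : Lin (∀ i, (X i).flagged) (∀ i, X i) :=
  piTensor fun i => (slice false : Lin (X i × Bool) (X i))

variable {K : ∀ i, Set (Lin (A i) (A' i))} {M : Set (Lin B B')}

/-! ### Locally-applicable transformations: affinity and postselection -/

namespace LocallyApplicable

variable (T : LocallyApplicable K M)

theorem natural_comp {f : ∀ i, Lin (Y i) (X i)} {g : ∀ i, Lin (X' i) (Y' i)}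
    (hf : ∀ i, IsChannel (f i)) (hg : ∀ i, IsChannel (g i))
    (φ : ∀ i, dExt (K i) (X i) (X' i)) (ψ : ∀ i, dExt (K i) (Y i) (Y' i))
    (h : ∀ i, (ψ i).1 = ampR (A' i) (g i) ∘ₗ (φ i).1 ∘ₗ ampR (A i) (f i)) :
    (T.toFun Y Y' ψ).1 =
      ampR B' (piTensor g) ∘ₗ (T.toFun X X' φ).1 ∘ₗ ampR B (piTensor f) := by
  rw [← multiSlide_unit]
  exact T.natural X X' Y Y' (fun _ => Sys.unit) _ _
    (fun i => (isChannel_relabel _).comp (hf i)) (fun i => (hg i).comp (isChannel_relabel _)) φ ψ h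

theorem natural_comp_left {g : ∀ i, Lin (X' i) (Y' i)} (hg : ∀ i, IsChannel (g i))
    (φ : ∀ i, dExt (K i) (X i) (X' i)) (ψ : ∀ i, dExt (K i) (X i) (Y' i))
    (h : ∀ i, (ψ i).1 = ampR (A' i) (g i) ∘ₗ (φ i).1) :
    (T.toFun X Y' ψ).1 = ampR B' (piTensor g) ∘ₗ (T.toFun X X' φ).1 := by
  rw [T.natural_comp (f := fun _ => LinearMap.id) (fun _ => isChannel_id) hg φ ψ h, piTensor_id]
  rfl

theorem natural_comp_right {f : ∀ i, Lin (Y i) (X i)} (hf : ∀ i, IsChannel (f i))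
    (φ : ∀ i, dExt (K i) (X i) (X' i)) (ψ : ∀ i, dExt (K i) (Y i) (X' i))
    (h : ∀ i, (ψ i).1 = (φ i).1 ∘ₗ ampR (A i) (f i)) :
    (T.toFun Y X' ψ).1 = (T.toFun X X' φ).1 ∘ₗ ampR B (piTensor f) := by
  rw [T.natural_comp (g := fun _ => LinearMap.id) hf (fun _ => isChannel_id) φ ψ h, piTensor_id]
  rfl

/-- A locally-applicable transformation is multi-affine. -/
theorem map_mix (hK : ∀ i, Convex ℝ (K i)) (w : Fin n → Bool → ℂ) (hw : ∀ i q, 0 ≤ w i q)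
    (hw1 : ∀ i, ∑ q, w i q = 1) (Φ : ∀ i, Bool → dExt (K i) (X i) (X' i))
    (ψ : ∀ i, dExt (K i) (X i) (X' i)) (hψ : ∀ i, (ψ i).1 = ∑ q, w i q • (Φ i q).1) :
    (T.toFun X X' ψ).1 =
      ∑ s : Fin n → Bool, (∏ i, w i (s i)) • (T.toFun X X' fun i => Φ i (s i)).1 := by
  -- Both `ψ` and each choice `Φ i (s i)` come from this one controlled family by preparing its
  -- control. Naturality reduces the claim to multilinearity of the tensor product of the
  -- preparations.
  let C : ∀ i, dExt (K i) (X i).flagged (X' i) := fun i =>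
    ⟨ctrl fun q => (Φ i q).1, ctrl_mem_dExt (hK i) fun q => (Φ i q).2⟩
  have hψ' := T.natural_comp_right (Y := X) (X := fun i => (X i).flagged)
    (fun i => isChannel_sum_flag (hw i) (hw1 i)) C ψ fun i => (hψ i).trans (mix_eq _ _)
  have hs : ∀ s : Fin n → Bool, (T.toFun X X' fun i => Φ i (s i)).1 = _ := fun s =>
    T.natural_comp_right (Y := X) (X := fun i => (X i).flagged)
      (fun i => isChannel_flag (s i)) C _ fun i => (ctrl_comp_flag (fun q => (Φ i q).1) (s i)).symm
  rw [hψ']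
  simp only [hs]
  have hsum : ∀ {α β : Type} (F : (Fin n → Bool) → Lin α β) (c : (Fin n → Bool) → ℂ),
      ampR B (∑ s, c s • F s) = ∑ s, c s • ampR B (F s) := by
    intro α β F c
    refine LinearMap.ext fun N => ?_
    ext p q
    simp only [LinearMap.sum_apply, Matrix.sum_apply]
    change (∑ s, c s • F s) _ _ _ = _
    simp only [LinearMap.sum_apply, Matrix.sum_apply]
    rfl
  rw [piTensor_sum_smul, hsum, comp_sum]
  simp only [LinearMap.comp_smul]

/-- Resetting the `i`-th flag to `true` is a channel that fixes the family, so by naturality it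
fixes the value of `T`. Projecting that flag onto `false` after the reset gives zero. -/
theorem postselect_eq_zero (φ : ∀ i, dExt (K i) (X i) (X' i).flagged) (i : Fin n)
    (χ : Lin (A i × X i) (A' i × X' i)) (h : (φ i).1 = ampR (A' i) (flag (X' i) true) ∘ₗ χ) :
    ampR B' (postselect X') ∘ₗ (T.toFun X (fun i => (X' i).flagged) φ).1 = 0 := by
  let g : ∀ j, Lin (X' j).flagged (X' j).flagged := fun j =>
    if j = i then flag (X' j) true ∘ₗ discardR (X' j) Bool else LinearMap.id
  have hg : ∀ j, IsChannel (g j) := by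
    intro j
    by_cases hj : j = i
    · simp only [g, if_pos hj]
      exact (isChannel_flag _).comp isChannel_discardR
    · simp only [g, if_neg hj]
      exact isChannel_id
  rw [T.natural_comp_left hg φ φ, ← LinearMap.comp_assoc, ← ampR_comp, postselect, piTensor_comp,
    piTensor_eq_zero i, ampR_zero, LinearMap.zero_comp]
  · simp only [g, if_pos]
    rw [← LinearMap.comp_assoc, slice_comp_flag, if_neg (by simp), LinearMap.zero_comp]
  · intro j
    by_cases hj : j = i
    · subst hj
      simp only [g, if_pos]
      rw [h, ← LinearMap.comp_assoc, ← ampR_comp, LinearMap.comp_assoc, discardR_comp_flag]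
      rfl
    · simp only [g, if_neg hj]
      rfl

/-- In the multi-affine expansion, every term but the one choosing `Ψ i` in all slots contains a
failure flag. -/
theorem postselect_mix (hK : ∀ i, Convex ℝ (K i)) {w v : Fin n → ℂ} (hw : ∀ i, 0 ≤ w i)
    (hv : ∀ i, 0 ≤ v i) (hwv : ∀ i, w i + v i = 1)
    (Ψ ψ : ∀ i, dExt (K i) (X i) (X' i).flagged) (χ : ∀ i, dExt (K i) (X i) (X' i))
    (hψ : ∀ i, (ψ i).1 =
      w i • (Ψ i).1 + v i • ampR (A' i) (flag (X' i) true) ∘ₗ (χ i).1) :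
    ampR B' (postselect X') ∘ₗ (T.toFun X (fun i => (X' i).flagged) ψ).1 =
      (∏ i, w i) • (ampR B' (postselect X') ∘ₗ (T.toFun X (fun i => (X' i).flagged) Ψ).1) := by
  let Φ : ∀ i, Bool → dExt (K i) (X i) (X' i).flagged := fun i q => bif q then
    ⟨ampR (A' i) (flag (X' i) true) ∘ₗ (χ i).1,
      comp_left_mem_dExt (isChannel_flag true) (χ i).2⟩ else Ψ i
  rw [T.map_mix hK (fun i q => bif q then v i else w i) (by rintro i (_ | _); exacts [hw i, hv i])
    (by intro i; simp [add_comm, ← hwv i]) Φ ψ (by intro i; simp [hψ i, Φ, add_comm]), comp_sum,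
    Fintype.sum_eq_single (fun _ => false)]
  · rw [LinearMap.comp_smul]
    rfl
  · intro s hs
    obtain ⟨i, hi⟩ := Function.ne_iff.mp hs
    rw [LinearMap.comp_smul, T.postselect_eq_zero _ i (χ i).1, smul_zero]
    simp [Φ, hi]

theorem postselect_flag (φ : ∀ i, dExt (K i) (X i) (X' i))
    (ψ : ∀ i, dExt (K i) (X i) (X' i).flagged)
    (h : ∀ i, (ψ i).1 = ampR (A' i) (flag (X' i) false) ∘ₗ (φ i).1) :
    ampR B' (postselect X') ∘ₗ (T.toFun X (fun i => (X' i).flagged) ψ).1 =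
      (T.toFun X X' φ).1 := by
  rw [T.natural_comp_left (Y' := fun i => (X' i).flagged) (fun i => isChannel_flag false) φ ψ h,
    ← LinearMap.comp_assoc, ← ampR_comp, postselect, piTensor_comp]
  simp only [slice_comp_flag, if_true]
  rw [piTensor_id]
  rfl

/-- A locally-applicable transformation is determined by its value at the swaps. -/
theorem eq_applyCP (hK : ∀ i, Convex ℝ (K i)) (hnormal : ∀ i, IsNormal (K i))
    {S : Lin (∀ i, A i × A' i) (B × B')}
    (hS : applyCP S (swaps A A') = (T.toFun A' A fun i => ⟨_, swap_mem_dExt (hnormal i)⟩).1)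
    (φ : ∀ i, dExt (K i) (X i) (X' i)) :
    (T.toFun X X' φ).1 = applyCP S fun i => (φ i).1 := by
  -- The success probability of teleportation.
  let p : Fin n → ℂ := fun i => (Fintype.card (A i) : ℂ)⁻¹ ^ 2
  have hp : ∀ i, 0 < p i := fun i => by
    have : (0 : ℂ) < (Fintype.card (A i) : ℂ) := by exact_mod_cast Fintype.card_pos
    positivity
  have hp1 : ∀ i, 0 < 1 + p i := fun i => add_pos zero_lt_one (hp i)
  let sw : ∀ i, dExt (K i) (A' i) (A i) := fun i => ⟨_, swap_mem_dExt (hnormal i)⟩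
  have hf := fun i => isChannel_encode (φ i).2.1
  let Ψ : ∀ i, dExt (K i) (X i) (X' i).flagged := fun i =>
    ⟨slide (encode (φ i).1) (bellMeasure (A i) (X' i)) (sw i).1,
      slide_mem_dExt (hf i) isChannel_bellMeasure (sw i).2⟩
  -- The measurement with its outcome forgotten: the sum of the success branch `p i • φ i` and the
  -- failure branch.
  let c : ∀ i, dExt (K i) (X i) (X' i) := fun i =>
    ⟨slide (encode (φ i).1) (discardR (X' i) (A i × A i) ∘ₗ relabel (regroup (A i) (X' i))) (sw i).1,
      slide_mem_dExt (hf i) (isChannel_discardR.comp (isChannel_relabel _)) (sw i).2⟩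
  let φ₀ : ∀ i, dExt (K i) (X i) (X' i).flagged := fun i =>
    ⟨ampR (A' i) (flag (X' i) false) ∘ₗ (φ i).1,
      comp_left_mem_dExt (isChannel_flag false) (φ i).2⟩
  have hΨ : ∀ i, (Ψ i).1 = p i • ampR (A' i) (flag (X' i) false) ∘ₗ (φ i).1 +
      ampR (A' i) (flag (X' i) true) ∘ₗ ((c i).1 - p i • (φ i).1) := by
    intro i
    have h : (c i).1 - p i • (φ i).1 = slide (encode (φ i).1)
        (effect (X' i) (1 - bellProj (A i)) ∘ₗ relabel (regroup (A i) (X' i))) (sw i).1 := by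
      rw [sub_eq_iff_eq_add, ← slide_encode_swap]
      rw [← slide_add_right, ← LinearMap.add_comp, ← effect_add, sub_add_cancel, effect_one]
    rw [h, ← LinearMap.comp_smul, ← slide_encode_swap]
    rfl
  have hsl : ∀ i, ampR (A' i) (slice false) ∘ₗ (Ψ i).1 = p i • (φ i).1 := by
    intro i
    rw [hΨ, LinearMap.comp_add, LinearMap.comp_smul, ← LinearMap.comp_assoc,
      ← LinearMap.comp_assoc, ← ampR_comp, ← ampR_comp, slice_comp_flag, slice_comp_flag,
      if_pos rfl, if_neg (by simp), ampR_zero, LinearMap.zero_comp, add_zero]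
    rfl
  -- Normalises the sum of `Ψ i`, of weight `1`, and the failure-flagged `φ i`, of weight `p i`.
  let w : Fin n → ℂ := fun i => (1 + p i)⁻¹
  have hw : ∀ i, 0 < w i := fun i => inv_pos.mpr (hp1 i)
  have hw1 : ∀ i, w i + w i * p i = 1 := fun i => by
    rw [← mul_one_add, inv_mul_cancel₀ (hp1 i).ne']
  let ψ : ∀ i, dExt (K i) (X i) (X' i).flagged := fun i =>
    ⟨_, mix_mem_dExt (hK i) (w := fun q => bif q then w i * p i else w i)
      (Φ := fun q => bif q then ampR (A' i) (flag (X' i) true) ∘ₗ (φ i).1 else (Ψ i).1)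
      (by rintro (_ | _); exacts [(hw i).le, (mul_pos (hw i) (hp i)).le])
      (by simp [add_comm, ← hw1 i])
      (by rintro (_ | _); exacts [(Ψ i).2, comp_left_mem_dExt (isChannel_flag true) (φ i).2])⟩
  have hψ : ∀ i, (ψ i).1 = w i • (Ψ i).1 +
      (w i * p i) • ampR (A' i) (flag (X' i) true) ∘ₗ (φ i).1 := fun i => by
    simp [ψ, add_comm]
  have e₁ := T.postselect_mix hK (fun i => (hw i).le) (fun i => (mul_pos (hw i) (hp i)).le) hw1
    Ψ ψ φ hψ
  -- The second decomposition of `ψ i`: the added `p i • φ i` cancels the negative term of the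
  -- failure branch, leaving `c i` flagged as failure and `p i • φ i` flagged as success.
  have e₂ := T.postselect_mix hK (fun i => (mul_pos (hw i) (hp i)).le) (fun i => (hw i).le)
    (fun i => (add_comm _ _).trans (hw1 i)) φ₀ ψ c fun i => by
      rw [hψ, hΨ, LinearMap.comp_sub, LinearMap.comp_smul, smul_add, smul_sub, smul_smul,
        smul_smul]
      abel
  rw [e₁, T.postselect_flag φ φ₀ fun i => rfl, Finset.prod_mul_distrib, mul_smul] at e₂
  have hw0 : ∏ i, w i ≠ 0 := Finset.prod_ne_zero_iff.mpr fun i _ => (hw i).ne'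
  have hp0 : ∏ i, p i ≠ 0 := Finset.prod_ne_zero_iff.mpr fun i _ => (hp i).ne'
  -- `Ψ` comes from the swaps by channels alone, so naturality of `T` and of `S` applies.
  have hTΨ : (T.toFun X (fun i => (X' i).flagged) Ψ).1 = applyCP S fun i => (Ψ i).1 := by
    rw [T.natural A' A X (fun i => (X' i).flagged) (fun i => ⟨X' i × A i⟩)
      (fun i => encode (φ i).1) (fun i => bellMeasure (A i) (X' i)) hf
      (fun i => isChannel_bellMeasure) sw Ψ fun i => rfl, ← hS, ← applyCP_slide]
    rfl
  have hpost : ampR B' (postselect X') ∘ₗ applyCP S (fun i => (Ψ i).1) =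
      applyCP S fun i => p i • (φ i).1 := by
    have h := applyCP_comp (Y := X) (X' := fun i => (X' i).flagged) S (fun _ => LinearMap.id)
      (fun i => (slice false : Lin (X' i × Bool) (X' i))) fun i => (Ψ i).1
    rw [piTensor_id] at h
    refine Eq.trans h.symm (congrArg (applyCP S) (funext fun i => ?_))
    exact hsl i
  rw [hTΨ, hpost, applyCP_smul] at e₂
  exact (smul_right_injective _ hp0 (smul_right_injective _ hw0 e₂)).symm

theorem ext_toFun {T T' : LocallyApplicable K M} (h : T.toFun = T'.toFun) : T = T' := by
  cases T
  cases T'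
  congr

end LocallyApplicable

/-- The locally-applicable transformation induced by a `CP`-supermap. -/
def CPSupermap.toLocallyApplicable (S : CPSupermap K M) : LocallyApplicable K M where
  toFun X X' φ := ⟨applyCP S.1 fun i => (φ i).1, S.2.2 X X' _ fun i => (φ i).2⟩
  natural X X' Y Y' Z f g _ _ φ ψ h := by
    simp only [h]
    exact applyCP_slide S.1 f g fun i => (φ i).1

end QSupermap

/-! ### The correspondence -/

theorem mainTheorem4 (n : ℕ) (A A' : Fin n → QSupermap.Sys) (B B' : QSupermap.Sys)
    (K : ∀ i, Set (QSupermap.Lin (A i) (A' i))) (M : Set (QSupermap.Lin B B'))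
    (hK : ∀ i, ∀ φ ∈ K i, QSupermap.IsChannel φ) (hM : ∀ φ ∈ M, QSupermap.IsChannel φ)
    (hKconvex : ∀ i, Convex ℝ (K i)) (hMconvex : Convex ℝ M)
    (hKnormal : ∀ i, QSupermap.IsNormal (K i)) :
    ∃ e : QSupermap.CPSupermap K M ≃ QSupermap.LocallyApplicable K M,
      ∀ (S : QSupermap.CPSupermap K M) (X X' : Fin n → QSupermap.Sys)
        (φ : ∀ i, QSupermap.dExt (K i) (X i) (X' i)),
        ((e S).toFun X X' φ).1 = QSupermap.applyCP S.1 (fun i => (φ i).1) := by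
  open QSupermap in
  refine ⟨Equiv.ofBijective CPSupermap.toLocallyApplicable ⟨fun S S' h => ?_, fun T => ?_⟩,
    fun _ _ _ _ => rfl⟩
  · have h' := congrArg (fun T : LocallyApplicable K M =>
      (T.toFun A' A fun i => ⟨_, swap_mem_dExt (hKnormal i)⟩).1) h
    exact Subtype.ext (applyCP_swaps_injective h')
  · obtain ⟨S, hS, hST⟩ := exists_applyCP_swaps_eq
      (T.toFun A' A fun i => ⟨_, swap_mem_dExt (hKnormal i)⟩).2.1.1
    have h := fun X X' => T.eq_applyCP (X := X) (X' := X') hKconvex hKnormal hST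
    -- `S` preserves extensions because its values are those of `T`.
    refine ⟨⟨S, hS, fun X X' φ hφ => ?_⟩, LocallyApplicable.ext_toFun ?_⟩
    · rw [← h X X' fun i => ⟨φ i, hφ i⟩]
      exact Subtype.prop _
    · funext X X' φ
      exact Subtype.ext (h X X' φ).symm
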